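/- Consider a two-player zero-sum stochastic game with finite state space $\mathcal S$, action sets $A_1=A_2=[0,1]$, discount factor $0\le\beta<1$, polynomial payoffs $r(s,a_1,a_2)=\sum_{i=0}^{n_s}\sum_{j=0}^{m_s} r_{ij}(s)\,a_1^i a_2^j$ with real coefficients, and transition probabilities $p(s';s,a_1)$ (from $s$ to $s'$) that depend only on player 1's action and are real polynomials in $a_1$ of degree at most $n_s$; thus $p(s';s,a_1)\ge 0$ and $\sum_{s'}p(s';s,a_1)=1$ for $a_1\in[0,1]$. For $n \ge 0$ let $\mathcal M_n$ be the set of vectors $(\mu_0,\dots,\mu_n)$ with $\mu_i=\int_{[0,1]}x^i\,d\mu$ for some finite nonnegative Borel measure $\mu$ supported on $[0,1]$. Let $(P')$ be the problem of minimizing $\sum_{s} v(s)$ over $v(s)\in\mathbb R$ and $\bar\nu(s)=(\nu_0(s),\dots,\nu_{m_s}(s))\in\mathcal M_{m_s}$, $s\in\mathcal S$, subject to $\nu_0(s)=1$ and $$v(s)-\sum_{i,j}r_{ij}(s)\,a_1^i\,\nu_j(s)-\beta\sum_{s'}p(s';s,a_1)\,v(s')\ \ge 0\qquad\text{for all } a_1\in[0,1],\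 s\in\mathcal S.$$ Let $(D')$ be the problem of maximizing $\sum_s\alpha(s)$ over $\alpha(s)\in\mathbb R$ and $\bar\xi(s)=(\xi_0(s),\dots,\xi_{n_s}(s))\in\mathcal M_{n_s}$, $s\in\mathcal S$, subject to $$\sum_{i,j}r_{ij}(s)\,\xi_i(s)\,a_2^j-\alpha(s)\ge 0\qquad\text{for all } a_2\in[0,1],\ s\in\mathcal S,$$ $$\sum_s\int_{A_1}\bigl(\delta(s,s')-\beta\, p(s';s,a_1)\bigr)\,d\xi(s)=1\qquad\text{for all } s'\in\mathcal S,$$ where the integrals, whose integrands are polynomials of degree at most $n_s$, are expressed through the moments $\bar\xi(s)$, and $\delta$ is the Kronecker delta. Let $(\bar\nu^*,v^*)$ be an optimal solution of $(P')$ and $(\bar\xi^*,\alpha^*)$ an optimal solution of $(D')$, and let $\nu^*(s)$ and $\xi^*(s)$ be finite nonnegative measures supported on $[0,1]$ with moments $\bar\nu^*(s)$ and $\bar\xi^*(s)$ respectively. Then for every $s\in\mathcal S$, $$v^*(s)\int_{A_1}d\xi^*(s)=\int_{A_2}\int_{A_1}r(s,a_1,a_2)\,d\xi^*(s)\,d\nu^*(s)+\beta\sum_{s'}v^*(s')\int_{A_1}p(s';s,a_1)\,d\xi^*(s)$$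 and $$\alpha^*(s)\int_{A_2}d\nu^*(s)=\int_{A_2}\int_{A_1}r(s,a_1,a_2)\,d\xi^*(s)\,d\nu^*(s).$$ -/

import Mathlib

open MeasureTheory Polynomial
open scoped BigOperators

noncomputable section

/-- `𝒫(A)`: the real univariate polynomials of degree at most `n` that are nonnegative on `A`. -/
def nonnegPolynomials (A : Set ℝ) (n : ℕ) : Set ℝ[X] :=
  {q | q.natDegree ≤ n ∧ ∀ x ∈ A, 0 ≤ q.eval x}

/-- `μ` is a (finite, nonnegative) measure supported on `A` whose moments of order `0, …, n`
are `x 0, …, x n`. -/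
structure RepresentsMoments (A : Set ℝ) {n : ℕ} (μ : Measure ℝ) (x : Fin (n + 1) → ℝ) :
    Prop where
  finite : IsFiniteMeasure μ
  supported : μ Aᶜ = 0
  moment_eq : ∀ i : Fin (n + 1), ∫ a in A, a ^ (i : ℕ) ∂μ = x i

/-- `𝓜(A)`: the moment sequences of length `n + 1` of measures supported on `A`. -/
def momentSpace (A : Set ℝ) (n : ℕ) : Set (Fin (n + 1) → ℝ) :=
  {x | ∃ μ : Measure ℝ, RepresentsMoments A μ x}

/-- The integral of a polynomial `q` of degree at most `n`, written in terms of the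
moments `x 0, …, x n` of the measure. -/
def momentIntegral {n : ℕ} (q : ℝ[X]) (x : Fin (n + 1) → ℝ) : ℝ :=
  ∑ i : Fin (n + 1), q.coeff i * x i

/-- `momentIntegral` is the integral against any measure on `[0,1]` with the given moments. -/
theorem momentIntegral_eq_integral {n : ℕ} {q : ℝ[X]} (hq : q.natDegree ≤ n) {μ : Measure ℝ}
    {x : Fin (n + 1) → ℝ} (h : RepresentsMoments (Set.Icc 0 1) μ x) :
    momentIntegral q x = ∫ a in Set.Icc (0 : ℝ) 1, q.eval a ∂μ := by
  have := h.finite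
  have hint : ∀ f : ℝ → ℝ, Continuous f → IntegrableOn f (Set.Icc (0 : ℝ) 1) μ :=
    fun f hf => hf.continuousOn.integrableOn_compact isCompact_Icc
  have he : ∀ a : ℝ, q.eval a = ∑ i : Fin (n + 1), q.coeff i * a ^ (i : ℕ) := by
    intro a
    rw [Polynomial.eval_eq_sum_range' (Nat.lt_succ_of_le hq),
      Finset.sum_range (fun i => q.coeff i * a ^ i)]
  simp_rw [he]
  rw [integral_finsetSum _ (fun i _ => hint _ (by fun_prop))]
  simp_rw [integral_const_mul, h.moment_eq]
  rfl

/-- A two-player zero-sum discounted stochastic game with finite state space `S`, action sets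
`A₁ = A₂ = [0,1]`, polynomial payoffs and polynomial transition probabilities controlled by
player 1 alone. -/
structure SingleControllerGame (S : Type*) [Fintype S] where
  /-- bound for the degree in `a₁` of the payoff and the transition probabilities at `s` -/
  deg₁ : S → ℕ
  /-- bound for the degree in `a₂` of the payoff at `s` -/
  deg₂ : S → ℕ
  /-- `r s i j` is the coefficient of `a₁ ^ i * a₂ ^ j` in the payoff polynomial at `s` -/
  r : ∀ s : S, Fin (deg₁ s + 1) → Fin (deg₂ s + 1) → ℝ
  /-- `p s' s` is the polynomial `a₁ ↦ p(s'; s, a₁)`, the probability of moving from `s`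
  to `s'` when player 1 plays `a₁` -/
  p : S → S → ℝ[X]
  p_natDegree_le : ∀ s' s, (p s' s).natDegree ≤ deg₁ s
  p_nonneg : ∀ s' s, ∀ a ∈ Set.Icc (0 : ℝ) 1, 0 ≤ (p s' s).eval a
  p_sum : ∀ s, ∀ a ∈ Set.Icc (0 : ℝ) 1, ∑ s', (p s' s).eval a = 1
  /-- the discount factor -/
  β : ℝ
  β_nonneg : 0 ≤ β
  β_lt_one : β < 1

namespace SingleControllerGame

variable {S : Type*} [Fintype S] (G : SingleControllerGame S)

/-- The payoff `r(s, a₁, a₂)`. -/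
def payoff (s : S) (a₁ a₂ : ℝ) : ℝ :=
  ∑ i, ∑ j, G.r s i j * a₁ ^ (i : ℕ) * a₂ ^ (j : ℕ)

/-- The polynomial in `a₁`
`v(s) - ∑_{i,j} r_{ij}(s) a₁ ^ i ν_j(s) - β ∑_{s'} p(s'; s, a₁) v(s')`. -/
def primalPolynomial (ν : ∀ s : S, Fin (G.deg₂ s + 1) → ℝ) (v : S → ℝ) (s : S) : ℝ[X] :=
  C (v s) - ∑ i : Fin (G.deg₁ s + 1), ∑ j : Fin (G.deg₂ s + 1),
      C (G.r s i j * ν s j) * X ^ (i : ℕ)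
    - C G.β * ∑ s', G.p s' s * C (v s')

/-- Feasibility for the primal program `(P')`. -/
structure PrimalFeasible (ν : ∀ s : S, Fin (G.deg₂ s + 1) → ℝ) (v : S → ℝ) : Prop where
  nonneg : ∀ s, G.primalPolynomial ν v s ∈ nonnegPolynomials (Set.Icc 0 1) (G.deg₁ s)
  moment : ∀ s, ν s ∈ momentSpace (Set.Icc 0 1) (G.deg₂ s)
  mass : ∀ s, ν s 0 = 1

/-- Optimality for `(P')`: minimize `∑ v(s)` over the feasible points. -/
structure PrimalOptimal (ν : ∀ s : S, Fin (G.deg₂ s + 1) → ℝ) (v : S → ℝ) : Prop where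
  feasible : G.PrimalFeasible ν v
  le : ∀ ν' v', G.PrimalFeasible ν' v' → ∑ s, v s ≤ ∑ s, v' s

open Classical in
/-- Feasibility for the dual program `(D')`. The last condition reads
`∑_s ∫ (δ(s,s') - β p(s'; s, a₁)) dξ(s) = 1`, the integral being expressed through the
moments of `ξ(s)`. -/
structure DualFeasible (ξ : ∀ s : S, Fin (G.deg₁ s + 1) → ℝ) (α : S → ℝ) : Prop where
  nonneg : ∀ s, ∀ a₂ ∈ Set.Icc (0 : ℝ) 1,
    0 ≤ (∑ i, ∑ j, G.r s i j * ξ s i * a₂ ^ (j : ℕ)) - α s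
  moment : ∀ s, ξ s ∈ momentSpace (Set.Icc 0 1) (G.deg₁ s)
  balance : ∀ s', ∑ s, momentIntegral (C (if s = s' then 1 else 0) - C G.β * G.p s' s) (ξ s) = 1

/-- Optimality for `(D')`: maximize `∑ α(s)` over the feasible points. -/
structure DualOptimal (ξ : ∀ s : S, Fin (G.deg₁ s + 1) → ℝ) (α : S → ℝ) : Prop where
  feasible : G.DualFeasible ξ α
  ge : ∀ ξ' α', G.DualFeasible ξ' α' → ∑ s, α' s ≤ ∑ s, α s

end SingleControllerGame

end

/-!
The two identities are complementary slackness for the pair of programs `(P')`, `(D')`.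

Integrate the polynomial constraint of `(P')` at `s` against `ξ s`, and the constraint of `(D')` at
`s` against `ν s`. The results, the slacks, are nonnegative, and by the balance constraint their sum
over all states is the duality gap `∑ v s - ∑ α s` (`sum_slacks_eq_gap`). If there is no gap, each
slack vanishes (`slacks_eq_zero`), which is the claim written in terms of moments.

The absence of a gap is shown by exhibiting feasible points of both programs with equal objectives
(`exists_feasible_without_gap`). The moment vectors of probability measures on `[0,1]` form a compact
convex set (`isCompact_mixedMoments`, `convex_mixedMoments`), on which the payoffs are bilinear, so
Sion's theorem gives optimal mixed strategies in the one-shot game with continuation value `v`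
(`exists_saddlePoint`). Its value is a `β`-contraction in `v`, and the fixed point, with player 2's
strategies, is feasible for `(P')` (`exists_shapley_equation`). As player 1 controls the
transitions, the strategies `x s` of player 1 define a stochastic matrix `P`; with
`ρ = 1 (I - β P)⁻¹ ≥ 0` (`exists_nonneg_discounted_occupation`) the measures `ρ s • x s` satisfy the
balance constraint, and Shapley's equation makes `α s = ρ s * (v s - β (P v) s)` feasible; these
values add up to `ρ (I - β P) v = ∑ v s`.
-/

/-! ### Moment vectors -/

section Moments

variable {n : ℕ}

theorem momentIntegral_sub (p q : ℝ[X]) (x : Fin (n + 1) → ℝ) :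
    momentIntegral (p - q) x = momentIntegral p x - momentIntegral q x := by
  simp [momentIntegral, sub_mul]

theorem momentIntegral_C (c : ℝ) (x : Fin (n + 1) → ℝ) :
    momentIntegral (C c) x = c * x 0 := by
  unfold momentIntegral
  rw [Finset.sum_eq_single 0]
  · simp
  · intro i _ hi
    have : (i : ℕ) ≠ 0 := fun h => hi (Fin.ext h)
    simp [coeff_C, this]
  · simp

theorem momentIntegral_C_mul (c : ℝ) (q : ℝ[X]) (x : Fin (n + 1) → ℝ) :
    momentIntegral (C c * q) x = c * momentIntegral q x := by
  simp [momentIntegral, Finset.mul_sum, mul_assoc]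

theorem momentIntegral_sum {ι : Type*} (t : Finset ι) (q : ι → ℝ[X]) (x : Fin (n + 1) → ℝ) :
    momentIntegral (∑ k ∈ t, q k) x = ∑ k ∈ t, momentIntegral (q k) x := by
  simp only [momentIntegral, finsetSum_coeff, Finset.sum_mul]
  exact Finset.sum_comm

theorem momentIntegral_X_pow (i : Fin (n + 1)) (x : Fin (n + 1) → ℝ) :
    momentIntegral (X ^ (i : ℕ)) x = x i := by
  unfold momentIntegral
  rw [Finset.sum_eq_single i]
  · simp
  · intro j _ hj
    have : (j : ℕ) ≠ i := fun h => hj (Fin.ext h)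
    simp [coeff_X_pow, this]
  · simp

theorem momentIntegral_add_smul (q : ℝ[X]) (a b : ℝ) (x y : Fin (n + 1) → ℝ) :
    momentIntegral q (a • x + b • y) = a * momentIntegral q x + b * momentIntegral q y := by
  simp only [momentIntegral, Finset.mul_sum, ← Finset.sum_add_distrib, Pi.add_apply, Pi.smul_apply,
    smul_eq_mul]
  exact Finset.sum_congr rfl fun i _ => by ring

theorem momentIntegral_smul (q : ℝ[X]) (a : ℝ) (x : Fin (n + 1) → ℝ) :
    momentIntegral q (a • x) = a * momentIntegral q x := by
  simpa using momentIntegral_add_smul q a 0 x 0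

@[fun_prop]
theorem continuous_momentIntegral (q : ℝ[X]) :
    Continuous fun x : Fin (n + 1) → ℝ => momentIntegral q x := by
  unfold momentIntegral
  fun_prop

theorem momentIntegral_nonneg {q : ℝ[X]} (hq : q ∈ nonnegPolynomials (Set.Icc 0 1) n)
    {x : Fin (n + 1) → ℝ} (hx : x ∈ momentSpace (Set.Icc 0 1) n) : 0 ≤ momentIntegral q x := by
  obtain ⟨μ, hμ⟩ := hx
  rw [momentIntegral_eq_integral hq.1 hμ]
  exact setIntegral_nonneg measurableSet_Icc hq.2

/-- The moment vectors form a convex cone. -/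
theorem add_smul_mem_momentSpace {A : Set ℝ} (hA : IsCompact A) {a b : ℝ} (ha : 0 ≤ a)
    (hb : 0 ≤ b) {x y : Fin (n + 1) → ℝ} (hx : x ∈ momentSpace A n) (hy : y ∈ momentSpace A n) :
    a • x + b • y ∈ momentSpace A n := by
  obtain ⟨μ, hμ⟩ := hx
  obtain ⟨ν, hν⟩ := hy
  have := hμ.finite
  have := hν.finite
  have hint : ∀ (κ : Measure ℝ) [IsFiniteMeasure κ] (i : ℕ),
      Integrable (fun t : ℝ => t ^ i) (κ.restrict A) := fun κ _ i =>
    (continuous_pow i).continuousOn.integrableOn_compact hA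
  refine ⟨a.toNNReal • μ + b.toNNReal • ν, inferInstance, ?_, fun i => ?_⟩
  · simp [hμ.supported, hν.supported]
  · rw [Measure.restrict_add, Measure.restrict_smul, Measure.restrict_smul,
      integral_add_measure ((hint μ i).smul_measure_nnreal) ((hint ν i).smul_measure_nnreal),
      integral_smul_nnreal_measure, integral_smul_nnreal_measure, hμ.moment_eq, hν.moment_eq]
    simp [NNReal.smul_def, ha, hb]

theorem smul_mem_momentSpace {A : Set ℝ} (hA : IsCompact A) {a : ℝ} (ha : 0 ≤ a)
    {x : Fin (n + 1) → ℝ} (hx : x ∈ momentSpace A n) : a • x ∈ momentSpace A n := by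
  simpa using add_smul_mem_momentSpace hA ha le_rfl hx hx

variable (n) in
/-- The moment vectors of order at most `n` of the probability measures on `[0,1]`, that is, of
the mixed strategies of a player with action set `[0,1]`. -/
def mixedMoments : Set (Fin (n + 1) → ℝ) :=
  {x | x ∈ momentSpace (Set.Icc 0 1) n ∧ x 0 = 1}

theorem convex_mixedMoments : Convex ℝ (mixedMoments n) := by
  intro x hx y hy a b ha hb hab
  exact ⟨add_smul_mem_momentSpace isCompact_Icc ha hb hx.1 hy.1, by simp [hx.2, hy.2, hab]⟩

theorem pow_mem_mixedMoments {a : ℝ} (ha : a ∈ Set.Icc (0 : ℝ) 1) :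
    (fun i : Fin (n + 1) => a ^ (i : ℕ)) ∈ mixedMoments n := by
  refine ⟨⟨Measure.dirac a, inferInstance, ?_, fun i => ?_⟩, by simp⟩
  · simp [ha]
  · rw [restrict_dirac' measurableSet_Icc]
    simp [ha]

theorem nonempty_mixedMoments : (mixedMoments n).Nonempty :=
  ⟨_, pow_mem_mixedMoments (a := 0) (by simp)⟩

/-- The probability measures on `[0,1]` form a compact space in the weak topology, and the moments
are weakly continuous. -/
theorem isCompact_mixedMoments : IsCompact (mixedMoments n) := by
  let m : ProbabilityMeasure unitInterval → Fin (n + 1) → ℝ :=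
    fun μ i => ∫ t, (t : ℝ) ^ (i : ℕ) ∂(μ : Measure unitInterval)
  have hm : Continuous m := by
    refine continuous_pi fun i => ?_
    let f : BoundedContinuousFunction unitInterval ℝ :=
      BoundedContinuousFunction.mkOfCompact ⟨fun t => (t : ℝ) ^ (i : ℕ), by fun_prop⟩
    exact ProbabilityMeasure.continuous_integral_boundedContinuousFunction f
  convert isCompact_range hm
  ext x
  constructor
  · rintro ⟨⟨μ, hμ⟩, hx⟩
    let κ : Measure unitInterval := μ.comap Subtype.val
    have hκ : ∀ f : ℝ → ℝ, ∫ t : unitInterval, f t ∂κ = ∫ t in Set.Icc (0 : ℝ) 1, f t ∂μ :=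
      fun f => integral_subtype_comap measurableSet_Icc f
    have := hμ.finite
    have hprob : IsProbabilityMeasure κ := by
      have h0 := hμ.moment_eq 0
      rw [hx] at h0
      simp [Measure.real] at h0
      constructor
      rw [Measure.comap_apply _ Subtype.val_injective
        (fun s hs => measurableSet_Icc.subtype_image hs) _ MeasurableSet.univ]
      simpa [Set.Icc, ENNReal.toReal_eq_one_iff] using h0
    exact ⟨⟨κ, hprob⟩, funext fun i => (hκ fun t => t ^ (i : ℕ)).trans (hμ.moment_eq i)⟩
  · rintro ⟨μ, rfl⟩
    have hme : MeasurableEmbedding (Subtype.val : unitInterval → ℝ) :=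
      MeasurableEmbedding.subtype_coe measurableSet_Icc
    refine ⟨⟨(μ : Measure unitInterval).map Subtype.val, inferInstance, ?_, fun i => ?_⟩, ?_⟩
    · rw [hme.map_apply]
      simp
    · rw [hme.setIntegral_map]
      simp [m]
    · simp [m]

theorem momentIntegral_pow {q : ℝ[X]} (hq : q.natDegree ≤ n) (a : ℝ) :
    momentIntegral q (fun i : Fin (n + 1) => a ^ (i : ℕ)) = q.eval a := by
  rw [Polynomial.eval_eq_sum_range' (Nat.lt_succ_of_le hq),
    Finset.sum_range (fun i => q.coeff i * a ^ i)]
  rfl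

end Moments

/-! ### Discounted occupation measures -/

/-- For a stochastic matrix `P` and `0 ≤ β < 1` the row vector `ρ = 1 (I - β P)⁻¹` is nonnegative.
Invertibility is diagonal dominance. If `N ≥ 0` is the negative part of `ρ`, then
`N ≤ β N P`, and summing the coordinates gives `∑ N ≤ β ∑ N`, so `N = 0`. -/
theorem exists_nonneg_discounted_occupation {S : Type*} [Fintype S] {β : ℝ} (hβ₀ : 0 ≤ β)
    (hβ₁ : β < 1) (P : S → S → ℝ) (hP : ∀ s s', 0 ≤ P s s') (hP₁ : ∀ s, ∑ s', P s s' = 1) :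
    ∃ ρ : S → ℝ, (∀ s, 0 ≤ ρ s) ∧ ∀ s', ρ s' - β * ∑ s, ρ s * P s s' = 1 := by
  classical
  let A : Matrix S S ℝ := 1 - β • Matrix.of P
  have hdet : A.det ≠ 0 := by
    refine det_ne_zero_of_sum_row_lt_diag fun k => ?_
    have hoff : ∑ j ∈ Finset.univ.erase k, ‖A k j‖ = β * (1 - P k k) := by
      rw [← hP₁ k, ← Finset.add_sum_erase _ _ (Finset.mem_univ k), add_sub_cancel_left,
        Finset.mul_sum]
      refine Finset.sum_congr rfl fun j hj => ?_
      have : k ≠ j := (Finset.ne_of_mem_erase hj).symm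
      simp [A, this, abs_of_nonneg hβ₀, abs_of_nonneg (hP k j)]
    have hdiag : A k k = 1 - β * P k k := by simp [A]
    rw [hoff, hdiag, Real.norm_eq_abs]
    refine lt_of_lt_of_le ?_ (le_abs_self _)
    linarith
  have hbal : ∀ ρ : S → ℝ, ∀ s', Matrix.vecMul ρ A s' = ρ s' - β * ∑ s, ρ s * P s s' := by
    intro ρ s'
    simp [A, Matrix.vecMul, dotProduct, Matrix.one_apply, mul_sub, Finset.mul_sum, mul_left_comm]
  let ρ : S → ℝ := Matrix.vecMul 1 A⁻¹
  have hρ : ∀ s', ρ s' - β * ∑ s, ρ s * P s s' = 1 := by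
    intro s'
    rw [← hbal, Matrix.vecMul_vecMul, Matrix.nonsing_inv_mul _ hdet.isUnit, Matrix.vecMul_one]
    rfl
  refine ⟨ρ, fun s => ?_, hρ⟩
  let N : S → ℝ := fun s => max (-ρ s) 0
  have hN₀ : ∀ s, 0 ≤ N s := fun s => le_max_right _ _
  have hN : ∀ s', N s' ≤ β * ∑ s, N s * P s s' := by
    intro s'
    have h₁ : ∑ s, -ρ s * P s s' ≤ ∑ s, N s * P s s' := Finset.sum_le_sum fun s _ =>
      mul_le_mul_of_nonneg_right (le_max_left _ _) (hP s s')
    have h₂ : 0 ≤ ∑ s, N s * P s s' := Finset.sum_nonneg fun s _ => mul_nonneg (hN₀ s) (hP s s')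
    simp only [neg_mul, Finset.sum_neg_distrib] at h₁
    refine max_le ?_ (mul_nonneg hβ₀ h₂)
    nlinarith [hρ s', mul_le_mul_of_nonneg_left h₁ hβ₀]
  have hsum : ∑ s, N s ≤ β * ∑ s, N s := by
    calc ∑ s', N s' ≤ ∑ s', β * ∑ s, N s * P s s' := Finset.sum_le_sum fun s' _ => hN s'
      _ = β * ∑ s, N s := by
        rw [← Finset.mul_sum, Finset.sum_comm]
        simp_rw [← Finset.mul_sum, hP₁, mul_one]
  have hzero : N s = 0 := by
    have hpos : 0 ≤ ∑ s, N s := Finset.sum_nonneg fun s _ => hN₀ s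
    have h0 : ∑ s, N s = 0 := by nlinarith
    exact (Finset.sum_eq_zero_iff_of_nonneg fun s _ => hN₀ s).1 h0 s (Finset.mem_univ s)
  have : -ρ s ≤ N s := le_max_left _ _
  linarith

namespace SingleControllerGame

variable {S : Type*} [Fintype S] (G : SingleControllerGame S)

/-! ### The payoffs in terms of moments -/

/-- The payoff at `s` of a pair of mixed strategies, in terms of the moments `x` of player 1 and
`y` of player 2. -/
def mixedPayoff (s : S) (x : Fin (G.deg₁ s + 1) → ℝ) (y : Fin (G.deg₂ s + 1) → ℝ) : ℝ :=
  ∑ i, ∑ j, G.r s i j * x i * y j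

/-- The probability, in terms of the moments `x` of player 1's mixed strategy at `s`, of moving
from `s` to `s'`. -/
def mixedTransition (s : S) (x : Fin (G.deg₁ s + 1) → ℝ) (s' : S) : ℝ :=
  momentIntegral (G.p s' s) x

theorem mixedPayoff_add_smul_left (s : S) (a b : ℝ) (x x' : Fin (G.deg₁ s + 1) → ℝ)
    (y : Fin (G.deg₂ s + 1) → ℝ) :
    G.mixedPayoff s (a • x + b • x') y = a * G.mixedPayoff s x y + b * G.mixedPayoff s x' y := by
  simp only [mixedPayoff, Finset.mul_sum, ← Finset.sum_add_distrib, Pi.add_apply, Pi.smul_apply,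
    smul_eq_mul]
  exact Finset.sum_congr rfl fun i _ => Finset.sum_congr rfl fun j _ => by ring

theorem mixedPayoff_add_smul_right (s : S) (a b : ℝ) (x : Fin (G.deg₁ s + 1) → ℝ)
    (y y' : Fin (G.deg₂ s + 1) → ℝ) :
    G.mixedPayoff s x (a • y + b • y') = a * G.mixedPayoff s x y + b * G.mixedPayoff s x y' := by
  simp only [mixedPayoff, Finset.mul_sum, ← Finset.sum_add_distrib, Pi.add_apply, Pi.smul_apply,
    smul_eq_mul]
  exact Finset.sum_congr rfl fun i _ => Finset.sum_congr rfl fun j _ => by ring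

theorem mixedTransition_nonneg {s : S} {x : Fin (G.deg₁ s + 1) → ℝ}
    (hx : x ∈ momentSpace (Set.Icc 0 1) (G.deg₁ s)) (s' : S) : 0 ≤ G.mixedTransition s x s' :=
  momentIntegral_nonneg ⟨G.p_natDegree_le s' s, G.p_nonneg s' s⟩ hx

theorem sum_mixedTransition (s : S) (x : Fin (G.deg₁ s + 1) → ℝ) :
    ∑ s', G.mixedTransition s x s' = x 0 := by
  -- The transition polynomials sum to `1` on `[0,1]`, which is infinite, hence as polynomials.
  have hsum : ∑ s', G.p s' s = C 1 := by
    refine Polynomial.eq_of_infinite_eval_eq _ _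
      ((Set.Icc_infinite (zero_lt_one (α := ℝ))).mono fun a ha => ?_)
    simp [eval_finsetSum, G.p_sum s a ha]
  simp only [mixedTransition]
  rw [← momentIntegral_sum, hsum, momentIntegral_C, one_mul]

theorem natDegree_primalPolynomial_le (ν : ∀ s : S, Fin (G.deg₂ s + 1) → ℝ) (v : S → ℝ) (s : S) :
    (G.primalPolynomial ν v s).natDegree ≤ G.deg₁ s := by
  refine (natDegree_sub_le _ _).trans (max_le ((natDegree_sub_le _ _).trans (max_le ?_ ?_)) ?_)
  · simp
  · exact natDegree_sum_le_of_forall_le _ _ fun i _ => natDegree_sum_le_of_forall_le _ _ fun j _ =>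
      (natDegree_C_mul_X_pow_le _ _).trans (Nat.le_of_lt_succ i.2)
  · exact (natDegree_C_mul_le _ _).trans (natDegree_sum_le_of_forall_le _ _ fun s' _ =>
      (natDegree_mul_C_le _ _).trans (G.p_natDegree_le s' s))

theorem momentIntegral_primalPolynomial (ν : ∀ s : S, Fin (G.deg₂ s + 1) → ℝ) (v : S → ℝ) (s : S)
    (x : Fin (G.deg₁ s + 1) → ℝ) :
    momentIntegral (G.primalPolynomial ν v s) x =
      v s * x 0 - G.mixedPayoff s x (ν s) - G.β * ∑ s', G.mixedTransition s x s' * v s' := by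
  simp only [primalPolynomial, momentIntegral_sub, momentIntegral_C, momentIntegral_sum,
    momentIntegral_C_mul, momentIntegral_X_pow, mixedPayoff, mixedTransition]
  refine congrArg₂ _ (congrArg _ ?_) (congrArg _ ?_)
  · exact Finset.sum_congr rfl fun i _ => Finset.sum_congr rfl fun j _ => by ring
  · refine Finset.sum_congr rfl fun s' _ => ?_
    rw [mul_comm, momentIntegral_C_mul, mul_comm]

/-- The constraint of `(D')` at the action `a₂` bounds `c` by the payoff of `x` against `a₂`. Being
polynomial in `a₂`, it can be integrated against any measure with moments `y`. -/
theorem dualSlack_nonneg {s : S} {x : Fin (G.deg₁ s + 1) → ℝ} {c : ℝ}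
    (h : ∀ a₂ ∈ Set.Icc (0 : ℝ) 1, 0 ≤ (∑ i, ∑ j, G.r s i j * x i * a₂ ^ (j : ℕ)) - c)
    {y : Fin (G.deg₂ s + 1) → ℝ} (hy : y ∈ momentSpace (Set.Icc 0 1) (G.deg₂ s)) :
    0 ≤ G.mixedPayoff s x y - c * y 0 := by
  let q : ℝ[X] := (∑ i, ∑ j : Fin (G.deg₂ s + 1), C (G.r s i j * x i) * X ^ (j : ℕ)) - C c
  have hq : q ∈ nonnegPolynomials (Set.Icc 0 1) (G.deg₂ s) := by
    refine ⟨(natDegree_sub_le _ _).trans (max_le ?_ ?_), fun a ha => ?_⟩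
    · exact natDegree_sum_le_of_forall_le _ _ fun i _ => natDegree_sum_le_of_forall_le _ _ fun j _ =>
        (natDegree_C_mul_X_pow_le _ _).trans (Nat.le_of_lt_succ j.2)
    · simp
    · simpa [q, eval_finsetSum] using h a ha
  have := momentIntegral_nonneg hq hy
  simpa only [q, momentIntegral_sub, momentIntegral_sum, momentIntegral_C_mul,
    momentIntegral_X_pow, momentIntegral_C, mixedPayoff] using this

/-! ### Weak duality -/

variable {G}

/-- The left side of the balance constraint of `(D')` at `s'`: the mass of `ξ s'` minus the
discounted inflow into `s'`. -/
theorem sum_momentIntegral_balance {ξ : ∀ s : S, Fin (G.deg₁ s + 1) → ℝ} (s' : S) [DecidableEq S] :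
    ∑ s, momentIntegral (C (if s = s' then 1 else 0) - C G.β * G.p s' s) (ξ s) =
      ξ s' 0 - G.β * ∑ s, G.mixedTransition s (ξ s) s' := by
  simp_rw [momentIntegral_sub, momentIntegral_C, momentIntegral_C_mul]
  simp [mixedTransition, Finset.mul_sum]

theorem DualFeasible.mass_sub_inflow {ξ : ∀ s : S, Fin (G.deg₁ s + 1) → ℝ} {α : S → ℝ}
    (h : G.DualFeasible ξ α) (s' : S) :
    ξ s' 0 - G.β * ∑ s, G.mixedTransition s (ξ s) s' = 1 := by
  classical
  rw [← sum_momentIntegral_balance]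
  convert h.balance s'

/-- The duality gap is the sum of the slacks of the two programs. -/
theorem sum_slacks_eq_gap {ν : ∀ s : S, Fin (G.deg₂ s + 1) → ℝ} {v : S → ℝ}
    {ξ : ∀ s : S, Fin (G.deg₁ s + 1) → ℝ} {α : S → ℝ}
    (hP : G.PrimalFeasible ν v) (hD : G.DualFeasible ξ α) :
    ∑ s, (momentIntegral (G.primalPolynomial ν v s) (ξ s) +
        (G.mixedPayoff s (ξ s) (ν s) - α s * ν s 0)) = ∑ s, v s - ∑ s, α s := by
  have hv : ∑ s, v s =
      ∑ s, (v s * ξ s 0 - G.β * ∑ s', G.mixedTransition s (ξ s) s' * v s') := by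
    calc ∑ s', v s' = ∑ s', v s' * (ξ s' 0 - G.β * ∑ s, G.mixedTransition s (ξ s) s') := by
          simp_rw [hD.mass_sub_inflow, mul_one]
      _ = _ := by
          simp only [mul_sub, Finset.sum_sub_distrib, Finset.mul_sum]
          congr 1
          rw [Finset.sum_comm]
          exact Finset.sum_congr rfl fun s _ => Finset.sum_congr rfl fun s' _ => by ring
  rw [hv, ← Finset.sum_sub_distrib]
  refine Finset.sum_congr rfl fun s _ => ?_
  rw [momentIntegral_primalPolynomial, hP.mass]
  ring

/-- Complementary slackness: without duality gap all the slacks, being nonnegative, vanish. -/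
theorem slacks_eq_zero {ν : ∀ s : S, Fin (G.deg₂ s + 1) → ℝ} {v : S → ℝ}
    {ξ : ∀ s : S, Fin (G.deg₁ s + 1) → ℝ} {α : S → ℝ}
    (hP : G.PrimalFeasible ν v) (hD : G.DualFeasible ξ α) (h : ∑ s, v s ≤ ∑ s, α s) (s : S) :
    momentIntegral (G.primalPolynomial ν v s) (ξ s) = 0 ∧
      G.mixedPayoff s (ξ s) (ν s) - α s * ν s 0 = 0 := by
  have h₁ : ∀ s, 0 ≤ momentIntegral (G.primalPolynomial ν v s) (ξ s) := fun s =>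
    momentIntegral_nonneg (hP.nonneg s) (hD.moment s)
  have h₂ : ∀ s, 0 ≤ G.mixedPayoff s (ξ s) (ν s) - α s * ν s 0 := fun s =>
    G.dualSlack_nonneg (hD.nonneg s) (hP.moment s)
  have hsum : ∑ s, (momentIntegral (G.primalPolynomial ν v s) (ξ s) +
      (G.mixedPayoff s (ξ s) (ν s) - α s * ν s 0)) = 0 :=
    le_antisymm (by rw [sum_slacks_eq_gap hP hD]; linarith)
      (Finset.sum_nonneg fun s _ => add_nonneg (h₁ s) (h₂ s))
  have := (Finset.sum_eq_zero_iff_of_nonneg fun s _ => add_nonneg (h₁ s) (h₂ s)).1 hsum s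
    (Finset.mem_univ s)
  exact ⟨by linarith [h₁ s, h₂ s], by linarith [h₁ s, h₂ s]⟩

/-! ### The Shapley operator -/

variable (G)

/-- The payoff of the one-shot game at `s` in which player 2 pays, on top of the payoff at `s`, the
discounted expected value `v` of the next state. -/
def shapleyPayoff (v : S → ℝ) (s : S) (y : Fin (G.deg₂ s + 1) → ℝ)
    (x : Fin (G.deg₁ s + 1) → ℝ) : ℝ :=
  G.mixedPayoff s x y + G.β * ∑ s', G.mixedTransition s x s' * v s'

theorem shapleyPayoff_add_smul_left (v : S → ℝ) (s : S) {a b : ℝ} (hab : a + b = 1)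
    (y y' : Fin (G.deg₂ s + 1) → ℝ) (x : Fin (G.deg₁ s + 1) → ℝ) :
    G.shapleyPayoff v s (a • y + b • y') x =
      a • G.shapleyPayoff v s y x + b • G.shapleyPayoff v s y' x := by
  simp only [shapleyPayoff, mixedPayoff_add_smul_right, smul_eq_mul]
  linear_combination (-(G.β * ∑ s', G.mixedTransition s x s' * v s')) * hab

theorem shapleyPayoff_add_smul_right (v : S → ℝ) (s : S) (a b : ℝ)
    (y : Fin (G.deg₂ s + 1) → ℝ) (x x' : Fin (G.deg₁ s + 1) → ℝ) :
    G.shapleyPayoff v s y (a • x + b • x') =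
      a • G.shapleyPayoff v s y x + b • G.shapleyPayoff v s y x' := by
  simp only [shapleyPayoff, mixedPayoff_add_smul_left, mixedTransition, momentIntegral_add_smul,
    smul_eq_mul, add_mul, Finset.sum_add_distrib, mul_assoc, ← Finset.mul_sum]
  ring

/-- The one-shot games have optimal mixed strategies, by the minimax theorem. -/
theorem exists_saddlePoint (v : S → ℝ) (s : S) :
    ∃ y ∈ mixedMoments (G.deg₂ s), ∃ x ∈ mixedMoments (G.deg₁ s),
      IsSaddlePointOn (mixedMoments (G.deg₂ s)) (mixedMoments (G.deg₁ s))
        (G.shapleyPayoff v s) y x := by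
  refine Sion.exists_isSaddlePointOn nonempty_mixedMoments convex_mixedMoments
    isCompact_mixedMoments (fun x _ => ?_) (fun x _ => ?_) convex_mixedMoments
    nonempty_mixedMoments isCompact_mixedMoments (fun y _ => ?_) (fun y _ => ?_)
  · refine (Continuous.lowerSemicontinuous ?_).lowerSemicontinuousOn _
    unfold shapleyPayoff mixedPayoff
    fun_prop
  · exact ConvexOn.quasiconvexOn ⟨convex_mixedMoments, fun y _ y' _ a b _ _ hab =>
      (G.shapleyPayoff_add_smul_left v s hab y y' x).le⟩
  · refine (Continuous.upperSemicontinuous ?_).upperSemicontinuousOn _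
    unfold shapleyPayoff mixedPayoff mixedTransition
    fun_prop
  · exact ConcaveOn.quasiconcaveOn ⟨convex_mixedMoments, fun x _ x' _ a b _ _ _ =>
      (G.shapleyPayoff_add_smul_right v s a b y x x').ge⟩

theorem shapleyPayoff_le_add_dist (v w : S → ℝ) (s : S) (y : Fin (G.deg₂ s + 1) → ℝ)
    {x : Fin (G.deg₁ s + 1) → ℝ} (hx : x ∈ mixedMoments (G.deg₁ s)) :
    G.shapleyPayoff v s y x ≤ G.shapleyPayoff w s y x + G.β * dist v w := by
  have h : ∑ s', G.mixedTransition s x s' * v s' ≤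
      ∑ s', G.mixedTransition s x s' * w s' + dist v w := by
    calc ∑ s', G.mixedTransition s x s' * v s'
        ≤ ∑ s', G.mixedTransition s x s' * (w s' + dist v w) := by
          refine Finset.sum_le_sum fun s' _ =>
            mul_le_mul_of_nonneg_left ?_ (G.mixedTransition_nonneg hx.1 s')
          have := (le_abs_self _).trans (dist_le_pi_dist v w s')
          linarith
      _ = _ := by
          simp_rw [mul_add, Finset.sum_add_distrib, ← Finset.sum_mul, sum_mixedTransition, hx.2,
            one_mul]
  have := mul_le_mul_of_nonneg_left h G.β_nonneg
  unfold shapleyPayoff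
  linarith

/-- Shapley's theorem: the operator sending `v` to the values of the one-shot games is a
`β`-contraction, so it has a fixed point. The strategies `y` and `x` are optimal in the one-shot
games of the fixed point `v`. -/
theorem exists_shapley_equation :
    ∃ (v : S → ℝ) (y : ∀ s, Fin (G.deg₂ s + 1) → ℝ) (x : ∀ s, Fin (G.deg₁ s + 1) → ℝ),
      (∀ s, y s ∈ mixedMoments (G.deg₂ s)) ∧ (∀ s, x s ∈ mixedMoments (G.deg₁ s)) ∧
      (∀ s, ∀ x' ∈ mixedMoments (G.deg₁ s), G.shapleyPayoff v s (y s) x' ≤ v s) ∧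
      ∀ s, ∀ y' ∈ mixedMoments (G.deg₂ s), v s ≤ G.shapleyPayoff v s y' (x s) := by
  choose y hy x hx hsaddle using G.exists_saddlePoint
  let T : (S → ℝ) → S → ℝ := fun v s => G.shapleyPayoff v s (y v s) (x v s)
  have hT : ∀ v w s, T v s ≤ T w s + G.β * dist v w := fun v w s =>
    calc T v s ≤ G.shapleyPayoff v s (y w s) (x v s) :=
          hsaddle v s (y w s) (hy w s) (x v s) (hx v s)
      _ ≤ G.shapleyPayoff w s (y w s) (x v s) + G.β * dist v w :=
          G.shapleyPayoff_le_add_dist v w s _ (hx v s)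
      _ ≤ T w s + G.β * dist v w :=
          add_le_add_left (hsaddle w s (y w s) (hy w s) (x v s) (hx v s)) _
  have hcontr : ContractingWith ⟨G.β, G.β_nonneg⟩ T := by
    refine ⟨by exact_mod_cast G.β_lt_one, LipschitzWith.of_dist_le_mul fun v w => ?_⟩
    refine (dist_pi_le_iff (mul_nonneg G.β_nonneg dist_nonneg)).2 fun s => ?_
    have h₁ := hT v w s
    have h₂ := hT w v s
    rw [dist_comm w v] at h₂
    rw [Real.dist_eq]
    change |_| ≤ G.β * dist v w
    exact abs_le.2 ⟨by linarith, by linarith⟩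
  let v := ContractingWith.fixedPoint T hcontr
  have hfix : T v = v := hcontr.fixedPoint_isFixedPt
  refine ⟨v, y v, x v, hy v, hx v, fun s x' hx' => ?_, fun s y' hy' => ?_⟩
  · exact (hsaddle v s (y v s) (hy v s) x' hx').trans_eq (congrFun hfix s)
  · exact (congrFun hfix s).symm.trans_le (hsaddle v s y' hy' (x v s) (hx v s))

/-! ### Strong duality -/

/-- The value of the game is feasible for `(P')` with player 2's optimal strategies; weighting
player 1's optimal strategies by the discounted occupation vector gives a feasible point of `(D')`
with the same objective. -/
theorem exists_feasible_without_gap :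
    ∃ ν v ξ α, G.PrimalFeasible ν v ∧ G.DualFeasible ξ α ∧ ∑ s, v s = ∑ s, α s := by
  classical
  obtain ⟨v, y, x, hy, hx, hv₁, hv₂⟩ := G.exists_shapley_equation
  let P : S → S → ℝ := fun s s' => G.mixedTransition s (x s) s'
  obtain ⟨ρ, hρ₀, hρ⟩ := exists_nonneg_discounted_occupation G.β_nonneg G.β_lt_one P
    (fun s s' => G.mixedTransition_nonneg (hx s).1 s')
    (fun s => (G.sum_mixedTransition s (x s)).trans (hx s).2)
  refine ⟨y, v, fun s => ρ s • x s, fun s => ρ s * (v s - G.β * ∑ s', P s s' * v s'),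
    ⟨fun s => ⟨G.natDegree_primalPolynomial_le y v s, fun a ha => ?_⟩, fun s => (hy s).1,
      fun s => (hy s).2⟩,
    ⟨fun s a ha => ?_, fun s => smul_mem_momentSpace isCompact_Icc (hρ₀ s) (hx s).1,
      fun s' => ?_⟩, ?_⟩
  · rw [← momentIntegral_pow (G.natDegree_primalPolynomial_le y v s),
      momentIntegral_primalPolynomial]
    have := hv₁ s _ (pow_mem_mixedMoments ha)
    simp only [shapleyPayoff] at this
    simp only [Fin.val_zero, pow_zero, mul_one]
    linarith
  · have h := hv₂ s _ (pow_mem_mixedMoments ha)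
    have hscale : ∑ i, ∑ j, G.r s i j * (ρ s • x s) i * a ^ (j : ℕ) =
        ρ s * G.mixedPayoff s (x s) (fun j => a ^ (j : ℕ)) := by
      simp only [mixedPayoff, Finset.mul_sum, Pi.smul_apply, smul_eq_mul]
      exact Finset.sum_congr rfl fun i _ => Finset.sum_congr rfl fun j _ => by ring
    rw [hscale, ← mul_sub]
    refine mul_nonneg (hρ₀ s) ?_
    simp only [shapleyPayoff] at h
    linarith
  · have h := hρ s'
    rw [show (1 : ℝ) = ρ s' - G.β * ∑ s, ρ s * P s s' from h.symm]
    refine Eq.trans ?_ ((sum_momentIntegral_balance (G := G) (ξ := fun s => ρ s • x s) s').trans ?_)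
    · congr!
    · simp [mixedTransition, momentIntegral_smul, (hx s').2, P]
  · calc ∑ s', v s' = ∑ s', v s' * (ρ s' - G.β * ∑ s, ρ s * P s s') := by
          simp_rw [hρ, mul_one]
      _ = _ := by
          simp only [mul_sub, Finset.sum_sub_distrib, Finset.mul_sum]
          congr 1
          · exact Finset.sum_congr rfl fun s _ => mul_comm _ _
          · rw [Finset.sum_comm]
            exact Finset.sum_congr rfl fun s _ => Finset.sum_congr rfl fun s' _ => by ring

variable {G}

theorem sum_primalOptimal_le_sum_dualOptimal {ν : ∀ s : S, Fin (G.deg₂ s + 1) → ℝ} {v : S → ℝ}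
    {ξ : ∀ s : S, Fin (G.deg₁ s + 1) → ℝ} {α : S → ℝ}
    (hP : G.PrimalOptimal ν v) (hD : G.DualOptimal ξ α) : ∑ s, v s ≤ ∑ s, α s := by
  obtain ⟨ν', v', ξ', α', hP', hD', h⟩ := G.exists_feasible_without_gap
  exact (hP.le ν' v' hP').trans (h.trans_le (hD.ge ξ' α' hD'))

/-! ### Back to integrals -/

variable (G)

theorem integral_integral_payoff (s : S) {μ ν : Measure ℝ} {x : Fin (G.deg₁ s + 1) → ℝ}
    {y : Fin (G.deg₂ s + 1) → ℝ} (hμ : RepresentsMoments (Set.Icc 0 1) μ x)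
    (hν : RepresentsMoments (Set.Icc 0 1) ν y) :
    ∫ a₂ in Set.Icc (0 : ℝ) 1, ∫ a₁ in Set.Icc (0 : ℝ) 1, G.payoff s a₁ a₂ ∂μ ∂ν =
      G.mixedPayoff s x y := by
  have := hμ.finite
  have := hν.finite
  have hint : ∀ (κ : Measure ℝ) [IsFiniteMeasure κ] (f : ℝ → ℝ), Continuous f →
      Integrable f (κ.restrict (Set.Icc (0 : ℝ) 1)) :=
    fun κ _ f hf => hf.continuousOn.integrableOn_compact isCompact_Icc
  have hinner : ∀ a₂ : ℝ, ∫ a₁ in Set.Icc (0 : ℝ) 1, G.payoff s a₁ a₂ ∂μ =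
      ∑ i, ∑ j, G.r s i j * x i * a₂ ^ (j : ℕ) := by
    intro a₂
    unfold payoff
    rw [integral_finsetSum _ fun i _ => hint μ _ (by fun_prop)]
    refine Finset.sum_congr rfl fun i _ => ?_
    rw [integral_finsetSum _ fun j _ => hint μ _ (by fun_prop)]
    refine Finset.sum_congr rfl fun j _ => ?_
    rw [integral_mul_const, integral_const_mul, hμ.moment_eq]
  simp_rw [hinner]
  rw [integral_finsetSum _ fun i _ => hint ν _ (by fun_prop)]
  refine Finset.sum_congr rfl fun i _ => ?_
  rw [integral_finsetSum _ fun j _ => hint ν _ (by fun_prop)]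
  refine Finset.sum_congr rfl fun j _ => ?_
  rw [integral_const_mul, hν.moment_eq]

end SingleControllerGame

theorem RepresentsMoments.integral_one {A : Set ℝ} {n : ℕ} {μ : Measure ℝ} {x : Fin (n + 1) → ℝ}
    (h : RepresentsMoments A μ x) : ∫ _a in A, (1 : ℝ) ∂μ = x 0 := by
  simpa using h.moment_eq 0

/-! ### Complementary slackness at optimal solutions -/

theorem mainTheorem5 {S : Type*} [Fintype S] (G : SingleControllerGame S)
    (νbar : ∀ s : S, Fin (G.deg₂ s + 1) → ℝ) (v : S → ℝ)
    (ξbar : ∀ s : S, Fin (G.deg₁ s + 1) → ℝ) (α : S → ℝ)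
    (hP : G.PrimalOptimal νbar v) (hD : G.DualOptimal ξbar α)
    (ν ξ : S → Measure ℝ)
    (hν : ∀ s, RepresentsMoments (Set.Icc 0 1) (ν s) (νbar s))
    (hξ : ∀ s, RepresentsMoments (Set.Icc 0 1) (ξ s) (ξbar s)) :
    (∀ s, v s * ∫ _a₁ in Set.Icc (0 : ℝ) 1, (1 : ℝ) ∂(ξ s) =
      (∫ a₂ in Set.Icc (0 : ℝ) 1, ∫ a₁ in Set.Icc (0 : ℝ) 1, G.payoff s a₁ a₂ ∂(ξ s) ∂(ν s)) +
        G.β * ∑ s', v s' * ∫ a₁ in Set.Icc (0 : ℝ) 1, (G.p s' s).eval a₁ ∂(ξ s)) ∧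
    (∀ s, α s * ∫ _a₂ in Set.Icc (0 : ℝ) 1, (1 : ℝ) ∂(ν s) =
      ∫ a₂ in Set.Icc (0 : ℝ) 1, ∫ a₁ in Set.Icc (0 : ℝ) 1, G.payoff s a₁ a₂ ∂(ξ s) ∂(ν s)) := by
  have hslack := SingleControllerGame.slacks_eq_zero hP.feasible hD.feasible
    (SingleControllerGame.sum_primalOptimal_le_sum_dualOptimal hP hD)
  refine ⟨fun s => ?_, fun s => ?_⟩
  · have h := (hslack s).1
    rw [G.momentIntegral_primalPolynomial] at h
    have hp : ∀ s', ∫ a₁ in Set.Icc (0 : ℝ) 1, (G.p s' s).eval a₁ ∂(ξ s) =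
        G.mixedTransition s (ξbar s) s' := fun s' =>
      (momentIntegral_eq_integral (G.p_natDegree_le s' s) (hξ s)).symm
    rw [(hξ s).integral_one, G.integral_integral_payoff s (hξ s) (hν s)]
    simp_rw [hp, mul_comm (v _)]
    linarith
  · rw [(hν s).integral_one, G.integral_integral_payoff s (hξ s) (hν s)]
    linarith [(hslack s).2]
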